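/- Let $d\ge 1$, let $S=\{x\in\mathbb R^d:|x|=1\}$, and write $x^{\sim}=|x|^{-1}x$ for $x\neq 0$. Elements $x\in S$ are read as row vectors, $\|A\|=\sup_{|x|=1}|xA|$ for a real $d\times d$ matrix $A$, and $\log^+ s=\max(\log s,0)$ for $s>0$, $\log^+0=0$. Let $(M_n,Q_n)_{n\ge1}$ be i.i.d. random variables with generic copy $(M,Q)$, where $M_n$ is a real $d\times d$ matrix and $Q_n$ is a (column) vector in $\mathbb R^d$; put $\Pi_0=I$ and $\Pi_n=M_1\cdots M_n$. Assume: (A1) $\mathbb E\log^+\|M\|<\infty$; (A2) $\mathbb E\log^+|Q|<\infty$; the Liapunov exponent $\beta\in[-\infty,\infty)$, given by $\beta=\lim_{n\to\infty}n^{-1}\log\|\Pi_n\|$ almost surely, satisfies $\beta<0$; (A3) $P(M\in GL(d,\mathbb R))=1$; (A4) for every $x\in S$ and every nonempty open $U\subset S$ there is $n\ge1$ with $P((x\Pi_n)^{\sim}\in U)>0$; (A5) there are $\Gamma_0\in GL(d,\mathbb R)$, $n_0\ge 1$ and $c,\gamma_0>0$ such that $P(\Pi_{n_0}\in\cdot)\ge\gamma_0\,\lambda(\,\cdot\cap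 B_c(\Gamma_0))$, where $\lambda$ is Lebesgue measure on the real $d\times d$ matrices, seen as $\mathbb R^{d^2}$, and $B_c(\Gamma_0)=\{A\in GL(d,\mathbb R):\|A-\Gamma_0\|<c\}$; (A6) $P(Mv+Q=v)<1$ for every column vector $v\in\mathbb R^d$; (A7) there is $\kappa_0>0$ with $\mathbb E\inf_{x\in S}|xM|^{\kappa_0}\ge1$, $\mathbb E\|M\|^{\kappa_0}\log^+\|M\|<\infty$ and $0<\mathbb E|Q|^{\kappa_0}<\infty$. Then the series $R:=\sum_{n\ge1}\Pi_{n-1}Q_n$ (whose law is the stationary solution of $R_n=M_nR_{n-1}+Q_n$) converges absolutely almost surely, and for every $x\in S$ and every $t\in\mathbb R$, $$P(xR\le t)<1 .$$ -/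

import Mathlib

open MeasureTheory ProbabilityTheory Filter Topology

noncomputable section

/-- The Euclidean space `ℝ^d`, used for row vectors as well as for column vectors; the product of
a row vector `x` and a column vector `y` is `inner ℝ x y`. -/
abbrev Vec (d : ℕ) : Type := EuclideanSpace ℝ (Fin d)

/-- Real `d × d` matrices. -/
abbrev Mat (d : ℕ) : Type := Matrix (Fin d) (Fin d) ℝ

/-- The Borel sigma-algebra on matrices, as the product sigma-algebra of the entries. -/
instance instMeasurableSpaceMat (d : ℕ) : MeasurableSpace (Mat d) :=
  (inferInstance : MeasurableSpace (Fin d → Fin d → ℝ))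

/-- The sigma-algebra on matrices is the Borel one. -/
instance instBorelSpaceMat (d : ℕ) : BorelSpace (Mat d) :=
  (inferInstance : BorelSpace (Fin d → Fin d → ℝ))

instance instSecondCountableMat (d : ℕ) : SecondCountableTopology (Mat d) :=
  (inferInstance : SecondCountableTopology (Fin d → Fin d → ℝ))

/-- The unit sphere `S = S^{d-1}` of `ℝ^d`. -/
abbrev unitSphere (d : ℕ) : Set (Vec d) := Metric.sphere (0 : Vec d) 1

/-- The product `A v` of a matrix and a column vector. -/
def mulCol {d : ℕ} (A : Mat d) (v : Vec d) : Vec d := WithLp.toLp 2 (A.mulVec v.ofLp)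

/-- The map `x ↦ x A` on row vectors, as a continuous linear map. -/
def rowMul {d : ℕ} (A : Mat d) : Vec d →L[ℝ] Vec d :=
  Matrix.toEuclideanCLM (𝕜 := ℝ) A.transpose

theorem rowMul_apply {d : ℕ} (A : Mat d) (x : Vec d) :
    rowMul A x = WithLp.toLp 2 (Matrix.vecMul x.ofLp A) := by
  ext i
  simp [rowMul, Matrix.mulVec_transpose]

/-- The norm `‖A‖ = sup_{|x| = 1} |x A|`, i.e. the operator norm of `x ↦ x A`. -/
def matNorm {d : ℕ} (A : Mat d) : ℝ := ‖rowMul A‖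

/-- The projection `x^~ = |x|⁻¹ x` to the unit sphere (the value at `0` is `0`, which is not on
the sphere). -/
def toSphere {d : ℕ} (x : Vec d) : Vec d := ‖x‖⁻¹ • x

/-- Lebesgue measure on the space of real `d × d` matrices, seen as `ℝ^{d²}`. -/
def matLebesgue (d : ℕ) : Measure (Mat d) :=
  (volume : Measure (Fin d → Fin d → ℝ)).map Matrix.of

/-- The open ball in `GL(d, ℝ)` with center `A` and radius `c`. -/
def glBall {d : ℕ} (A : Mat d) (c : ℝ) : Set (Mat d) := {B | IsUnit B ∧ matNorm (B - A) < c}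

/-- The product `Π_n = M_1 ⋯ M_n` with `Π_0 = I`. Sequences are indexed from `0` in the code:
`M n` stands for `M_{n+1}`. -/
def matProd {Ω : Type*} {d : ℕ} (M : ℕ → Ω → Mat d) : ℕ → Ω → Mat d
  | 0, _ => 1
  | n + 1, ω => matProd M n ω * M n ω

/-- `β ∈ [-∞, ∞]` is the Liapunov exponent: `n⁻¹ log ‖Π_n‖ → β` almost surely
(with `log 0 = -∞`). -/
def IsLiapunovExponent {Ω : Type*} [MeasurableSpace Ω] {d : ℕ} (μ : Measure Ω)
    (M : ℕ → Ω → Mat d) (β : EReal) : Prop :=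
  ∀ᵐ ω ∂μ, Tendsto
    (fun n : ℕ => ENNReal.log (ENNReal.ofReal (matNorm (matProd M n ω))) / (n : EReal))
    atTop (𝓝 β)

/-- The terms `Π_{n-1} Q_n`, `n ≥ 1`, of the series for `R` (with `n` shifted by one). -/
def solTerm {Ω : Type*} {d : ℕ} (M : ℕ → Ω → Mat d) (Q : ℕ → Ω → Vec d) (n : ℕ) (ω : Ω) : Vec d :=
  mulCol (matProd M n ω) (Q n ω)

/-- The stationary solution `R = ∑_{n ≥ 1} Π_{n-1} Q_n`. -/
def stationarySol {Ω : Type*} {d : ℕ} (M : ℕ → Ω → Mat d) (Q : ℕ → Ω → Vec d) (ω : Ω) : Vec d :=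
  ∑' n : ℕ, solTerm M Q n ω

end

/-!
Convergence: a negative Liapunov exponent makes `‖Π_n‖` decay exponentially, while the moment of
order `κ₀` keeps `|Q_n|` below any exponential (`ae_exists_forall_pow_mul_rpow_norm_le`), so the
series converges (`ae_summable_solTerm`).

Unboundedness: let `K` be the support of the law of `R`. Since `R = M R' + Q` with `R'` independent
of `(M, Q)` and distributed as `R`, the affine maps `v ↦ M_n v + Q_n` almost surely map the closed
set `K` into itself (`ae_mapsTo_support`). Suppose that `x R ≤ t` almost surely for some `x ∈ S`.
Then `x` is bounded above on `K`, and by invariance so are all `x Π_n`. Their directions are dense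
in the sphere by irreducibility, hence `K` is bounded
(`isBounded_of_bddAbove_of_irreducible`). Moreover `K` has at least two points, since a one-point
support would be a common fixed point of the maps, which nondegeneracy excludes.

If `inf_{|x| = 1} |x M| > 1`, then `v ↦ M v + Q` is expanding, and an expanding affine map cannot
send a bounded set with two points into itself (`subsingleton_of_mapsTo_expanding`). Hence
`inf_{|x| = 1} |x M| ≤ 1` almost surely. Its `κ₀`-th power has mean at least `1`, so the infimum
equals `1` almost surely, and `‖Π_n‖ ≥ 1` for all `n`. This contradicts the negativity of the
Liapunov exponent (`IsLiapunovExponent.nonneg_of_expanding`).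
-/

/-! ### Row and column actions of a matrix -/

theorem rowMul_one {d : ℕ} (x : Vec d) : rowMul (1 : Mat d) x = x := by
  simp [rowMul_apply]

theorem rowMul_mul {d : ℕ} (A B : Mat d) (x : Vec d) :
    rowMul (A * B) x = rowMul B (rowMul A x) := by
  simp [rowMul_apply, Matrix.vecMul_vecMul]

theorem mulCol_one {d : ℕ} (v : Vec d) : mulCol (1 : Mat d) v = v := by
  simp [mulCol]

theorem mulCol_mul {d : ℕ} (A B : Mat d) (v : Vec d) :
    mulCol (A * B) v = mulCol A (mulCol B v) := by
  simp [mulCol, Matrix.mulVec_mulVec]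

theorem mulCol_sub {d : ℕ} (A : Mat d) (v w : Vec d) :
    mulCol A (v - w) = mulCol A v - mulCol A w := by
  simp [mulCol, Matrix.mulVec_sub]

theorem mulCol_sum {d : ℕ} {ι : Type*} (A : Mat d) (s : Finset ι) (v : ι → Vec d) :
    mulCol A (∑ i ∈ s, v i) = ∑ i ∈ s, mulCol A (v i) := by
  change Matrix.toEuclideanCLM (𝕜 := ℝ) A _ = ∑ i ∈ s, Matrix.toEuclideanCLM (𝕜 := ℝ) A _
  exact map_sum _ _ _

theorem continuous_mulCol {d : ℕ} : Continuous fun p : Mat d × Vec d => mulCol p.1 p.2 := by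
  unfold mulCol
  fun_prop

theorem continuous_rowMul_apply {d : ℕ} (x : Vec d) : Continuous fun A : Mat d => rowMul A x := by
  simp only [rowMul_apply]
  fun_prop

/-- Associativity of the product of a row vector, a matrix and a column vector. -/
theorem inner_rowMul {d : ℕ} (A : Mat d) (x v : Vec d) :
    inner ℝ (rowMul A x) v = inner ℝ x (mulCol A v) := by
  simp only [rowMul_apply, mulCol, EuclideanSpace.inner_eq_star_dotProduct, star_trivial]
  rw [dotProduct_comm, ← Matrix.dotProduct_mulVec, dotProduct_comm]

theorem norm_mulCol_le {d : ℕ} (A : Mat d) (v : Vec d) : ‖mulCol A v‖ ≤ matNorm A * ‖v‖ := by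
  rcases (norm_nonneg (mulCol A v)).eq_or_lt with h | h
  · rw [← h]
    exact mul_nonneg (norm_nonneg _) (norm_nonneg _)
  · refine le_of_mul_le_mul_left ?_ h
    calc ‖mulCol A v‖ * ‖mulCol A v‖ = inner ℝ (rowMul A (mulCol A v)) v := by
          rw [inner_rowMul, real_inner_self_eq_norm_mul_norm]
      _ ≤ ‖rowMul A (mulCol A v)‖ * ‖v‖ := real_inner_le_norm _ _
      _ ≤ (matNorm A * ‖mulCol A v‖) * ‖v‖ := by
          gcongr
          exact (rowMul A).le_opNorm _
      _ = ‖mulCol A v‖ * (matNorm A * ‖v‖) := by ring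

/-- A lower bound for the row action passes to the column action: both are governed by the norm of
the inverse matrix. -/
theorem le_norm_mulCol_of_le_norm_rowMul {d : ℕ} {A : Mat d} {a : ℝ} (ha : 0 < a)
    (hA : ∀ x : Vec d, a * ‖x‖ ≤ ‖rowMul A x‖) (v : Vec d) : a * ‖v‖ ≤ ‖mulCol A v‖ := by
  have hinj : Function.Injective (rowMul A).toLinearMap := by
    rw [← LinearMap.ker_eq_bot, LinearMap.ker_eq_bot']
    intro x hx
    have h := hA x
    rw [show rowMul A x = 0 from hx, norm_zero] at h
    exact norm_le_zero_iff.1 (nonpos_of_mul_nonpos_right h ha)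
  obtain ⟨x, rfl⟩ := LinearMap.surjective_of_injective hinj v
  change a * ‖rowMul A x‖ ≤ ‖mulCol A (rowMul A x)‖
  rcases (norm_nonneg (rowMul A x)).eq_or_lt with h | h
  · rw [← h, mul_zero]
    exact norm_nonneg _
  · refine le_of_mul_le_mul_left ?_ h
    calc ‖rowMul A x‖ * (a * ‖rowMul A x‖) = a * inner ℝ x (mulCol A (rowMul A x)) := by
          rw [← inner_rowMul, real_inner_self_eq_norm_mul_norm]
          ring
      _ ≤ a * (‖x‖ * ‖mulCol A (rowMul A x)‖) := by
          gcongr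
          exact real_inner_le_norm _ _
      _ = (a * ‖x‖) * ‖mulCol A (rowMul A x)‖ := by ring
      _ ≤ ‖rowMul A x‖ * ‖mulCol A (rowMul A x)‖ := by
          gcongr
          exact hA x

/-- A lower bound for `inf_{|x| = 1} |x A|^κ`, written for arbitrary row vectors. -/
theorem rpow_inv_mul_norm_le_norm_rowMul {d : ℕ} {A : Mat d} {κ b : ℝ} (hκ : 0 < κ) (hb : 0 ≤ b)
    (h : b ≤ ⨅ x : unitSphere d, ‖rowMul A x‖ ^ κ) (x : Vec d) :
    b ^ κ⁻¹ * ‖x‖ ≤ ‖rowMul A x‖ := by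
  rcases eq_or_ne x 0 with rfl | hx
  · simp
  have hx' : 0 < ‖x‖ := norm_pos_iff.2 hx
  have hmem : ‖x‖⁻¹ • x ∈ unitSphere d := by
    simp [norm_smul, hx'.ne']
  have h1 : b ≤ ‖rowMul A (‖x‖⁻¹ • x)‖ ^ κ :=
    h.trans (ciInf_le ⟨0, by rintro _ ⟨y, rfl⟩; positivity⟩ (⟨_, hmem⟩ : unitSphere d))
  have h2 : b ^ κ⁻¹ ≤ ‖rowMul A (‖x‖⁻¹ • x)‖ :=
    (Real.rpow_inv_le_iff_of_pos hb (norm_nonneg _) hκ).2 h1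
  rw [map_smul, norm_smul, norm_inv, norm_norm, inv_mul_eq_div, le_div_iff₀ hx'] at h2
  exact h2

/-! ### Sets that are invariant under random affine maps -/

/-- An expanding affine map cannot map a bounded set with two distinct points into itself: the
distance of the iterates of the two points would be unbounded. -/
theorem subsingleton_of_mapsTo_expanding {d : ℕ} {A : Mat d} {q : Vec d} {K : Set (Vec d)} {a : ℝ}
    (ha : 1 < a) (hA : ∀ x : Vec d, a * ‖x‖ ≤ ‖rowMul A x‖)
    (hK : Bornology.IsBounded K) (hmaps : ∀ v ∈ K, mulCol A v + q ∈ K) : K.Subsingleton := by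
  have hcol := le_norm_mulCol_of_le_norm_rowMul (zero_lt_one.trans ha) hA
  have hexp : ∀ (n : ℕ) (v w : Vec d), v ∈ K → w ∈ K →
      ∃ v' ∈ K, ∃ w' ∈ K, a ^ n * ‖v - w‖ ≤ ‖v' - w'‖ := by
    intro n v w hv hw
    induction n with
    | zero => exact ⟨v, hv, w, hw, by simp⟩
    | succ n ih =>
      obtain ⟨v', hv', w', hw', h⟩ := ih
      refine ⟨_, hmaps v' hv', _, hmaps w' hw', ?_⟩
      rw [add_sub_add_right_eq_sub, ← mulCol_sub, pow_succ', mul_assoc]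
      exact (mul_le_mul_of_nonneg_left h (by linarith)).trans (hcol _)
  intro v hv w hw
  by_contra hne
  have hpos : 0 < ‖v - w‖ := norm_pos_iff.2 (sub_ne_zero.2 hne)
  obtain ⟨C, hC⟩ := Metric.isBounded_iff.1 hK
  obtain ⟨n, hn⟩ := pow_unbounded_of_one_lt (C / ‖v - w‖) ha
  obtain ⟨v', hv', w', hw', h⟩ := hexp n v w hv hw
  rw [div_lt_iff₀ hpos] at hn
  have := hC hv' hw'
  rw [dist_eq_norm] at this
  linarith

theorem bddAbove_inner_rowMul {d : ℕ} {A : Mat d} {q : Vec d} {K : Set (Vec d)}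
    (hmaps : ∀ v ∈ K, mulCol A v + q ∈ K) {x : Vec d}
    (hx : BddAbove ((fun v => (inner ℝ x v : ℝ)) '' K)) :
    BddAbove ((fun v => (inner ℝ (rowMul A x) v : ℝ)) '' K) := by
  obtain ⟨C, hC⟩ := hx
  refine ⟨C - inner ℝ x q, ?_⟩
  rintro _ ⟨v, hv, rfl⟩
  have := hC ⟨_, hmaps v hv, rfl⟩
  simp only [inner_add_right] at this
  simp only [inner_rowMul]
  linarith

/-- A set is bounded if the linear functionals that are bounded above on it meet every open half
space: otherwise its points of large norm would accumulate in a direction `u`, and no functional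
positive at `u` would be bounded above. -/
theorem isBounded_of_bddAbove_inner {d : ℕ} {K : Set (Vec d)}
    (h : ∀ u ∈ unitSphere d, ∃ y : Vec d, 0 < (inner ℝ y u : ℝ) ∧
      BddAbove ((fun v => (inner ℝ y v : ℝ)) '' K)) : Bornology.IsBounded K := by
  by_contra hK
  have hbig : ∀ n : ℕ, ∃ v ∈ K, (n : ℝ) < ‖v‖ := by
    intro n
    by_contra! hn
    exact hK (isBounded_iff_forall_norm_le.2 ⟨n, hn⟩)
  choose k hkK hk using hbig
  have hpos : ∀ n, 0 < ‖k n‖ := fun n => (Nat.cast_nonneg n).trans_lt (hk n)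
  obtain ⟨u, hu, φ, hφ, hlim⟩ := (isCompact_sphere (0 : Vec d) 1).tendsto_subseq
    (x := fun n => ‖k n‖⁻¹ • k n) (fun n => by simp [norm_smul, (hpos n).ne'])
  obtain ⟨y, hy, C, hC⟩ := h u hu
  have hlim' : Tendsto (fun n => (inner ℝ y (‖k (φ n)‖⁻¹ • k (φ n)) : ℝ)) atTop
      (𝓝 (inner ℝ y u)) := tendsto_const_nhds.inner hlim
  have hnorm : Tendsto (fun n => ‖k (φ n)‖) atTop atTop :=
    tendsto_atTop_mono (fun n => (hk (φ n)).le)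
      (tendsto_natCast_atTop_atTop.comp hφ.tendsto_atTop)
  obtain ⟨n, hn⟩ := ((hnorm.atTop_mul_pos hy hlim').eventually_gt_atTop C).exists
  have := hC ⟨_, hkK (φ n), rfl⟩
  simp only [real_inner_smul_right] at this hn
  rw [mul_inv_cancel_left₀ (hpos _).ne'] at hn
  exact absurd this (not_le.2 hn)

/-! ### Convergence of the series -/

/-- A negative exponential growth rate, in the extended sense with `log 0 = -∞`, means exponential
decay. -/
theorem eventually_le_exp_of_tendsto_log_div {a : ℕ → ℝ} (ha : ∀ n, 0 ≤ a n) {β : EReal} {δ : ℝ}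
    (hδ : β < ((-δ : ℝ) : EReal))
    (h : Tendsto (fun n : ℕ => ENNReal.log (ENNReal.ofReal (a n)) / (n : EReal)) atTop (𝓝 β)) :
    ∀ᶠ n : ℕ in atTop, a n ≤ Real.exp (-δ * n) := by
  filter_upwards [h.eventually_lt_const hδ, eventually_gt_atTop 0] with n hn hn0
  rcases (ha n).eq_or_lt with h0 | h0
  · rw [← h0]
    positivity
  · rw [ENNReal.log_ofReal_of_pos h0, ← EReal.coe_natCast, ← EReal.coe_div,
      EReal.coe_lt_coe_iff, div_lt_iff₀ (by exact_mod_cast hn0)] at hn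
    exact (Real.log_le_iff_le_exp h0).1 hn.le

/-- Identically distributed variables with a finite moment of order `κ` grow slower than any
geometric sequence, since `∑ r ^ n * |Q n| ^ κ` has finite mean. -/
theorem ae_exists_forall_pow_mul_rpow_norm_le {Ω E : Type*} [MeasurableSpace Ω] {μ : Measure Ω}
    [NormedAddCommGroup E] [MeasurableSpace E] [BorelSpace E] {Q : ℕ → Ω → E}
    (hident : ∀ n, IdentDistrib (Q n) (Q 0) μ μ) {κ : ℝ} (hκ : 0 < κ)
    (hmom : ∫⁻ ω, ENNReal.ofReal (‖Q 0 ω‖ ^ κ) ∂μ < ⊤) {r : ℝ} (hr0 : 0 ≤ r) (hr1 : r < 1) :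
    ∀ᵐ ω ∂μ, ∃ C : ℝ, 0 ≤ C ∧ ∀ n, r ^ n * ‖Q n ω‖ ^ κ ≤ C := by
  have hcont : Continuous fun v : E => ENNReal.ofReal (‖v‖ ^ κ) :=
    ENNReal.continuous_ofReal.comp (continuous_norm.rpow_const fun _ => Or.inr hκ.le)
  have hmeas : ∀ n, AEMeasurable (fun ω => ENNReal.ofReal (‖Q n ω‖ ^ κ)) μ := fun n =>
    hcont.measurable.comp_aemeasurable (hident n).aemeasurable_fst
  have hsum : ∫⁻ ω, ∑' n, ENNReal.ofReal r ^ n * ENNReal.ofReal (‖Q n ω‖ ^ κ) ∂μ ≠ ⊤ := by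
    rw [lintegral_tsum fun n => (hmeas n).const_mul _]
    have : ∀ n, ∫⁻ ω, ENNReal.ofReal r ^ n * ENNReal.ofReal (‖Q n ω‖ ^ κ) ∂μ
        = ENNReal.ofReal r ^ n * ∫⁻ ω, ENNReal.ofReal (‖Q 0 ω‖ ^ κ) ∂μ := fun n => by
      rw [lintegral_const_mul'' _ (hmeas n)]
      congr 1
      exact ((hident n).comp hcont.measurable).lintegral_eq
    simp_rw [this]
    rw [ENNReal.tsum_mul_right, ENNReal.tsum_geometric]
    refine ENNReal.mul_ne_top (ENNReal.inv_ne_top.2 ?_) hmom.ne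
    rw [← ENNReal.ofReal_one]
    exact (tsub_pos_of_lt ((ENNReal.ofReal_lt_ofReal_iff zero_lt_one).2 hr1)).ne'
  filter_upwards [ae_lt_top' (AEMeasurable.tsum fun n => (hmeas n).const_mul _) hsum]
    with ω hω
  refine ⟨(∑' n, ENNReal.ofReal r ^ n * ENNReal.ofReal (‖Q n ω‖ ^ κ)).toReal,
    ENNReal.toReal_nonneg, fun n => ?_⟩
  have := ENNReal.toReal_mono hω.ne
    (ENNReal.le_tsum (f := fun n => ENNReal.ofReal r ^ n * ENNReal.ofReal (‖Q n ω‖ ^ κ)) n)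
  rwa [← ENNReal.ofReal_pow hr0, ← ENNReal.ofReal_mul (by positivity),
    ENNReal.toReal_ofReal (by positivity)] at this

theorem ae_summable_solTerm {Ω : Type*} [MeasurableSpace Ω] {μ : Measure Ω} {d : ℕ}
    {M : ℕ → Ω → Mat d} {Q : ℕ → Ω → Vec d} (hident : ∀ n, IdentDistrib (Q n) (Q 0) μ μ)
    {β : EReal} (hβ : IsLiapunovExponent μ M β) (hβneg : β < 0) {κ : ℝ} (hκ : 0 < κ)
    (hmom : ∫⁻ ω, ENNReal.ofReal (‖Q 0 ω‖ ^ κ) ∂μ < ⊤) :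
    ∀ᵐ ω ∂μ, Summable fun n => solTerm M Q n ω := by
  obtain ⟨s, hβs, hs0⟩ := EReal.lt_iff_exists_real_btwn.1 hβneg
  obtain ⟨δ, hδ, rfl⟩ : ∃ δ : ℝ, 0 < δ ∧ s = -(2 * δ) :=
    ⟨-s / 2, by have : s < 0 := by exact_mod_cast hs0
                linarith, by ring⟩
  have hr1 : Real.exp (-(δ * κ)) < 1 := Real.exp_lt_one_iff.2 (neg_lt_zero.2 (mul_pos hδ hκ))
  filter_upwards [hβ, ae_exists_forall_pow_mul_rpow_norm_le hident hκ hmom (Real.exp_nonneg _) hr1]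
    with ω hω ⟨C, hC0, hC⟩
  -- `|Π_n| ≤ e ^ (-2δn)` eventually, while `|Q_n| ≤ C' e ^ (δn)`
  have hQ : ∀ n, ‖Q n ω‖ ≤ C ^ κ⁻¹ * Real.exp (δ * n) := by
    intro n
    have h1 : (Real.exp (-(δ * n)) * ‖Q n ω‖) ^ κ ≤ C := by
      rw [Real.mul_rpow (Real.exp_nonneg _) (norm_nonneg _), ← Real.exp_mul]
      refine le_trans (le_of_eq ?_) (hC n)
      rw [← Real.exp_nat_mul]
      ring_nf
    have h2 := (Real.le_rpow_inv_iff_of_pos (by positivity) hC0 hκ).2 h1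
    rw [Real.exp_neg, inv_mul_le_iff₀ (Real.exp_pos _)] at h2
    linarith
  have hgeo : Summable fun n : ℕ => C ^ κ⁻¹ * Real.exp (-δ) ^ n :=
    (summable_geometric_of_lt_one (Real.exp_nonneg _)
      (Real.exp_lt_one_iff.2 (neg_lt_zero.2 hδ))).mul_left _
  refine Summable.of_norm_bounded_eventually_nat hgeo ?_
  filter_upwards [eventually_le_exp_of_tendsto_log_div (fun n => norm_nonneg _) hβs hω] with n hn
  calc ‖solTerm M Q n ω‖ ≤ matNorm (matProd M n ω) * ‖Q n ω‖ := norm_mulCol_le _ _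
    _ ≤ Real.exp (-(2 * δ) * n) * (C ^ κ⁻¹ * Real.exp (δ * n)) := by
        gcongr
        · exact hn
        · exact hQ n
    _ = C ^ κ⁻¹ * Real.exp (-δ) ^ n := by
        rw [← Real.exp_nat_mul, mul_left_comm, ← Real.exp_add]
        ring_nf

/-! ### Stationarity -/

/-- For an i.i.d. sequence, the first member is independent of the shifted sequence, and the latter
has the law of the sequence itself. -/
theorem map_prodMk_shift_of_iIndepFun {Ω E : Type*} [MeasurableSpace Ω] {μ : Measure Ω}
    [IsProbabilityMeasure μ] [MeasurableSpace E] {X : ℕ → Ω → E} (hX : ∀ n, Measurable (X n))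
    (hindep : iIndepFun X μ) (hident : ∀ n, IdentDistrib (X n) (X 0) μ μ) :
    μ.map (fun ω => (X 0 ω, fun n => X (n + 1) ω)) =
      (μ.map (X 0)).prod (μ.map fun ω n => X n ω) := by
  have hshift : μ.map (fun ω n => X (n + 1) ω) = μ.map fun ω n => X n ω := by
    rw [(hindep.precomp (g := fun n : ℕ => n + 1) (add_left_injective 1)).map_fun_eq_infinitePi_map
      fun n => hX (n + 1), hindep.map_fun_eq_infinitePi_map hX]
    congr 1
    funext n
    rw [(hident (n + 1)).map_eq, (hident n).map_eq]
  rw [← hshift, ← indepFun_iff_map_prod_eq_prod_map_map (hX 0).aemeasurable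
    (measurable_pi_lambda _ fun n => hX (n + 1)).aemeasurable]
  have hd : Disjoint ({0} : Set ℕ) (Set.Ioi 0) := by simp
  have h := indep_iSup_of_disjoint (fun n => (hX n).comap_le) hindep hd
  refine indep_of_indep_of_le_left (indep_of_indep_of_le_right h ?_) ?_
  · rw [MeasurableSpace.comap_process_pi]
    exact iSup_le fun n => le_iSup₂_of_le (n + 1) (Nat.succ_pos n) le_rfl
  · exact le_iSup₂_of_le 0 rfl le_rfl

/-- The value of the series as a function of the driving sequence. It agrees with the sum
whenever the series converges, and it is measurable on the whole sequence space. -/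
noncomputable def seriesLimit {d : ℕ} (s : ℕ → Mat d × Vec d) : Vec d :=
  limUnder atTop fun N : ℕ =>
    ∑ n ∈ Finset.range N, solTerm (fun k t => (t k).1) (fun k t => (t k).2) n s

theorem measurable_matProd {Ω : Type*} [MeasurableSpace Ω] {d : ℕ} {M : ℕ → Ω → Mat d}
    (hM : ∀ n, Measurable (M n)) (n : ℕ) : Measurable (matProd M n) := by
  induction n with
  | zero => exact measurable_const
  | succ n ih =>
    have hc : Continuous fun p : Mat d × Mat d => p.1 * p.2 := by fun_prop
    exact hc.measurable.comp (ih.prodMk (hM n))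

theorem measurable_seriesLimit {d : ℕ} : Measurable (seriesLimit (d := d)) := by
  refine (StronglyMeasurable.limUnder fun N => Measurable.stronglyMeasurable ?_).measurable
  refine Finset.measurable_sum _ fun n _ => ?_
  exact continuous_mulCol.measurable.comp
    ((measurable_matProd (fun k => (measurable_pi_apply k).fst) n).prodMk
      (measurable_pi_apply n).snd)

theorem matProd_coord {Ω : Type*} {d : ℕ} (M : ℕ → Ω → Mat d) (Q : ℕ → Ω → Vec d) (n : ℕ) (ω : Ω) :
    matProd (fun k (t : ℕ → Mat d × Vec d) => (t k).1) n (fun k => (M k ω, Q k ω)) =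
      matProd M n ω := by
  induction n with
  | zero => rfl
  | succ n ih => simp only [matProd, ih]

theorem seriesLimit_eq {Ω : Type*} {d : ℕ} {M : ℕ → Ω → Mat d} {Q : ℕ → Ω → Vec d} {ω : Ω}
    {r : Vec d} (h : Tendsto (fun N => ∑ n ∈ Finset.range N, solTerm M Q n ω) atTop (𝓝 r)) :
    seriesLimit (fun k => (M k ω, Q k ω)) = r := by
  unfold seriesLimit
  simp only [solTerm, matProd_coord] at h ⊢
  exact h.limUnder_eq

theorem matProd_succ_eq {Ω : Type*} {d : ℕ} (M : ℕ → Ω → Mat d) (n : ℕ) (ω : Ω) :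
    matProd M (n + 1) ω = M 0 ω * matProd (fun k => M (k + 1)) n ω := by
  induction n with
  | zero => simp [matProd]
  | succ n ih =>
    rw [matProd, ih, Matrix.mul_assoc]
    rfl

/-- The recursion `R = M R' + Q`, where `R'` is the series of the shifted sequence. -/
theorem stationarySol_eq_mulCol_add {Ω : Type*} {d : ℕ} {M : ℕ → Ω → Mat d} {Q : ℕ → Ω → Vec d}
    {ω : Ω} (h : Summable fun n => solTerm M Q n ω) (hM : IsUnit (M 0 ω)) :
    stationarySol M Q ω =
      mulCol (M 0 ω) (seriesLimit fun k => (M (k + 1) ω, Q (k + 1) ω)) + Q 0 ω := by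
  set r := stationarySol M Q ω
  have hlim : Tendsto (fun N => ∑ n ∈ Finset.range N, solTerm M Q n ω) atTop (𝓝 r) :=
    h.hasSum.tendsto_sum_nat
  obtain ⟨B, hB⟩ := hM.exists_left_inv
  have hstep : ∀ N, ∑ n ∈ Finset.range (N + 1), solTerm M Q n ω =
      mulCol (M 0 ω) (∑ n ∈ Finset.range N,
        solTerm (fun k => M (k + 1)) (fun k => Q (k + 1)) n ω) + Q 0 ω := by
    intro N
    rw [Finset.sum_range_succ', mulCol_sum]
    congr 1
    · exact Finset.sum_congr rfl fun n _ => by rw [solTerm, matProd_succ_eq, mulCol_mul]; rfl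
    · exact mulCol_one _
  -- the shifted series converges because `M 0` is invertible
  have hlim' : Tendsto (fun N => ∑ n ∈ Finset.range N,
      solTerm (fun k => M (k + 1)) (fun k => Q (k + 1)) n ω) atTop
      (𝓝 (mulCol B (r - Q 0 ω))) := by
    have hc : Continuous fun v => mulCol B (v - Q 0 ω) :=
      continuous_mulCol.comp (continuous_const.prodMk (continuous_id.sub continuous_const))
    have := (hc.tendsto r).comp (hlim.comp (tendsto_add_atTop_nat 1))
    refine this.congr fun N => ?_
    simp only [Function.comp_apply, hstep, add_sub_cancel_right]
    rw [← mulCol_mul, hB, mulCol_one]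
  rw [seriesLimit_eq (M := fun k => M (k + 1)) (Q := fun k => Q (k + 1)) hlim', ← mulCol_mul,
    mul_eq_one_comm.1 hB, mulCol_one, sub_add_cancel]

theorem aemeasurable_stationarySol {Ω : Type*} [MeasurableSpace Ω] {μ : Measure Ω}
    {d : ℕ} {M : ℕ → Ω → Mat d} {Q : ℕ → Ω → Vec d}
    (hM : ∀ n, Measurable (M n)) (hQ : ∀ n, Measurable (Q n))
    (hsum : ∀ᵐ ω ∂μ, Summable fun n => solTerm M Q n ω) :
    AEMeasurable (stationarySol M Q) μ := by
  refine aemeasurable_of_tendsto_metrizable_ae' (f := fun N ω =>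
    ∑ n ∈ Finset.range N, solTerm M Q n ω) (fun N => ?_) ?_
  · exact (Finset.measurable_sum _ fun n _ => continuous_mulCol.measurable.comp
      ((measurable_matProd hM n).prodMk (hQ n))).aemeasurable
  · filter_upwards [hsum] with ω hω using hω.hasSum.tendsto_sum_nat

/-- The support of the law of `R` is almost surely mapped into itself by `v ↦ M v + Q`. -/
theorem ae_mapsTo_support {Ω : Type*} [MeasurableSpace Ω] {μ : Measure Ω} [IsProbabilityMeasure μ]
    {d : ℕ} {M : ℕ → Ω → Mat d} {Q : ℕ → Ω → Vec d}
    (hM : ∀ n, Measurable (M n)) (hQ : ∀ n, Measurable (Q n))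
    (hindep : iIndepFun (fun n ω => (M n ω, Q n ω)) μ)
    (hident : ∀ n, IdentDistrib (fun ω => (M n ω, Q n ω)) (fun ω => (M 0 ω, Q 0 ω)) μ μ)
    (hsum : ∀ᵐ ω ∂μ, Summable fun n => solTerm M Q n ω) (hunit : ∀ᵐ ω ∂μ, IsUnit (M 0 ω)) :
    ∀ᵐ ω ∂μ, ∀ v ∈ (μ.map (stationarySol M Q)).support,
      mulCol (M 0 ω) v + Q 0 ω ∈ (μ.map (stationarySol M Q)).support := by
  set X : ℕ → Ω → Mat d × Vec d := fun n ω => (M n ω, Q n ω) with hXdef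
  have hX : ∀ n, Measurable (X n) := fun n => (hM n).prodMk (hQ n)
  have hXpi : Measurable fun ω n => X n ω := measurable_pi_lambda _ hX
  set ν := μ.map (stationarySol M Q) with hν
  have hR : stationarySol M Q =ᵐ[μ] fun ω => seriesLimit fun n => X n ω := by
    filter_upwards [hsum] with ω hω
    exact (seriesLimit_eq hω.hasSum.tendsto_sum_nat).symm
  have hRm := aemeasurable_stationarySol hM hQ hsum
  have hlaw : (μ.map fun ω n => X n ω).map seriesLimit = ν := by
    rw [hν, Measure.map_congr hR, Measure.map_map measurable_seriesLimit hXpi]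
    rfl
  have hjoint := map_prodMk_shift_of_iIndepFun hX hindep hident
  have hclosed : IsClosed ν.support := Measure.isClosed_support
  have hcont : Continuous fun p : (Mat d × Vec d) × Vec d => mulCol p.1.1 p.2 + p.1.2 :=
    (continuous_mulCol.comp (continuous_fst.fst.prodMk continuous_snd)).add continuous_fst.snd
  have hae : ∀ᵐ ω ∂μ, mulCol (X 0 ω).1 (seriesLimit fun n => X (n + 1) ω) + (X 0 ω).2
      ∈ ν.support := by
    filter_upwards [hsum, hunit, ae_of_ae_map (p := (· ∈ ν.support)) hRm Measure.support_mem_ae]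
      with ω h1 h2 h3
    rwa [stationarySol_eq_mulCol_add h1 h2] at h3
  have hmeas : Measurable fun p : (Mat d × Vec d) × (ℕ → Mat d × Vec d) =>
      mulCol p.1.1 (seriesLimit p.2) + p.1.2 :=
    hcont.measurable.comp (measurable_fst.prodMk (measurable_seriesLimit.comp measurable_snd))
  have hpair : Measurable fun ω => (X 0 ω, fun n => X (n + 1) ω) :=
    (hX 0).prodMk (measurable_pi_lambda _ fun n => hX (n + 1))
  have hprod : ∀ᵐ p ∂(μ.map (X 0)).prod (μ.map fun ω n => X n ω),
      mulCol p.1.1 (seriesLimit p.2) + p.1.2 ∈ ν.support := by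
    rw [← hjoint]
    exact (ae_map_iff hpair.aemeasurable (hmeas hclosed.measurableSet)).2 hae
  have hfib := ae_of_ae_map (hX 0).aemeasurable (Measure.ae_ae_of_ae_prod hprod)
  filter_upwards [hfib] with ω hω
  have hcl : IsClosed {v | mulCol (M 0 ω) v + Q 0 ω ∈ ν.support} :=
    hclosed.preimage (hcont.comp (continuous_const.prodMk continuous_id :
      Continuous fun v : Vec d => ((M 0 ω, Q 0 ω), v)))
  have hfull : ∀ᵐ v ∂(μ.map fun ω n => X n ω).map seriesLimit,
      mulCol (M 0 ω) v + Q 0 ω ∈ ν.support :=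
    (ae_map_iff measurable_seriesLimit.aemeasurable hcl.measurableSet).2 hω
  rw [hlaw] at hfull
  exact Measure.support_subset_of_isClosed hcl hfull

/-! ### The support of the law of the solution -/

/-- If a set invariant under the maps `v ↦ M_n v + Q_n` is bounded above in one direction `x`, it is
so in the directions of all `x Π_n`; these are dense, so the set is bounded. -/
theorem isBounded_of_bddAbove_of_irreducible {Ω : Type*} [MeasurableSpace Ω] {μ : Measure Ω}
    {d : ℕ} {M : ℕ → Ω → Mat d} {Q : ℕ → Ω → Vec d} {K : Set (Vec d)} {x : Vec d}
    (hmaps : ∀ᵐ ω ∂μ, ∀ n, ∀ v ∈ K, mulCol (M n ω) v + Q n ω ∈ K)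
    (hirr : ∀ U : Set (unitSphere d), IsOpen U → U.Nonempty →
      ∃ n : ℕ, 1 ≤ n ∧
        0 < μ {ω | toSphere (rowMul (matProd M n ω) x) ∈ ((↑) '' U : Set (Vec d))})
    (hx : BddAbove ((fun v => (inner ℝ x v : ℝ)) '' K)) : Bornology.IsBounded K := by
  refine isBounded_of_bddAbove_inner fun u hu => ?_
  obtain ⟨n, -, hn⟩ := hirr {s | 0 < (inner ℝ (s : Vec d) u : ℝ)}
    (isOpen_lt continuous_const (continuous_subtype_val.inner continuous_const))
    ⟨⟨u, hu⟩, by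
      have : ‖u‖ = 1 := by simpa using hu
      simp [this]⟩
  obtain ⟨ω, hω, hmapsω⟩ := ((frequently_ae_iff.2 hn.ne').and_eventually hmaps).exists
  refine ⟨rowMul (matProd M n ω) x, ?_, ?_⟩
  · obtain ⟨s, hs, hs'⟩ := hω
    rw [Set.mem_ofPred_eq, hs', toSphere, real_inner_smul_left] at hs
    exact pos_of_mul_pos_right hs (by positivity)
  · clear hω hn
    induction n with
    | zero => simpa [matProd, rowMul_one] using hx
    | succ n ih =>
      rw [matProd, rowMul_mul]
      exact bddAbove_inner_rowMul (hmapsω n) ih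

theorem one_le_matNorm_matProd {Ω : Type*} {d : ℕ} {M : ℕ → Ω → Mat d} {ω : Ω}
    (h : ∀ n (y : Vec d), ‖y‖ ≤ ‖rowMul (M n ω) y‖) {x : Vec d} (hx : ‖x‖ = 1) (n : ℕ) :
    1 ≤ matNorm (matProd M n ω) := by
  have hn : ‖x‖ ≤ ‖rowMul (matProd M n ω) x‖ := by
    induction n with
    | zero => simp [matProd, rowMul_one]
    | succ n ih =>
      rw [matProd, rowMul_mul]
      exact ih.trans (h n _)
  have := (rowMul (matProd M n ω)).le_opNorm x
  rw [hx] at hn this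
  rw [mul_one] at this
  exact hn.trans this

/-- If the products do not contract, the Liapunov exponent is nonnegative. -/
theorem IsLiapunovExponent.nonneg_of_expanding {Ω : Type*} [MeasurableSpace Ω] {μ : Measure Ω}
    [NeZero μ] {d : ℕ} {M : ℕ → Ω → Mat d} {β : EReal} (hβ : IsLiapunovExponent μ M β)
    (h : ∀ᵐ ω ∂μ, ∀ n (y : Vec d), ‖y‖ ≤ ‖rowMul (M n ω) y‖) {x : Vec d} (hx : ‖x‖ = 1) :
    0 ≤ β := by
  obtain ⟨ω, h1, h2⟩ := (hβ.and h).exists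
  refine ge_of_tendsto' h1 fun n => EReal.div_nonneg ?_ (by positivity)
  rw [ENNReal.zero_le_log_iff, ENNReal.one_le_ofReal]
  exact one_le_matNorm_matProd h2 hx n

theorem mainTheorem5 {Ω : Type*} [MeasurableSpace Ω] (μ : Measure Ω) [IsProbabilityMeasure μ]
    (d : ℕ) (M : ℕ → Ω → Mat d) (Q : ℕ → Ω → Vec d)
    -- `(M_n, Q_n)` are i.i.d. random variables; `(M 0, Q 0)` serves as the generic copy `(M, Q)`
    (hM : ∀ n, Measurable (M n)) (hQ : ∀ n, Measurable (Q n))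
    (hindep : iIndepFun (fun n ω => (M n ω, Q n ω)) μ)
    (hident : ∀ n, IdentDistrib (fun ω => (M n ω, Q n ω)) (fun ω => (M 0 ω, Q 0 ω)) μ μ)
    -- logarithmic moments, and negativity of the Liapunov exponent
    (hA1 : ∫⁻ ω, ENNReal.ofReal (Real.posLog (matNorm (M 0 ω))) ∂μ < ⊤)
    (hA2 : ∫⁻ ω, ENNReal.ofReal (Real.posLog ‖Q 0 ω‖) ∂μ < ⊤)
    (β : EReal) (hβ : IsLiapunovExponent μ M β) (hβneg : β < 0)
    -- `M` is almost surely regular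
    (hA3 : ∀ᵐ ω ∂μ, IsUnit (M 0 ω))
    -- irreducibility on the sphere
    (hA4 : ∀ x ∈ unitSphere d, ∀ U : Set (unitSphere d), IsOpen U → U.Nonempty →
      ∃ n : ℕ, 1 ≤ n ∧
        0 < μ {ω | toSphere (rowMul (matProd M n ω) x) ∈ ((↑) '' U : Set (Vec d))})
    -- some product dominates Lebesgue measure on a ball of `GL(d, ℝ)`
    (hA5 : ∃ (Γ₀ : Mat d) (n₀ : ℕ) (c γ₀ : ℝ), IsUnit Γ₀ ∧ 1 ≤ n₀ ∧ 0 < c ∧ 0 < γ₀ ∧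
      ENNReal.ofReal γ₀ • (matLebesgue d).restrict (glBall Γ₀ c) ≤ μ.map (matProd M n₀))
    -- nondegeneracy
    (hA6 : ∀ v : Vec d, μ {ω | mulCol (M 0 ω) v + Q 0 ω = v} < 1)
    -- moment conditions of order `κ₀`
    (hA7 : ∃ κ₀ : ℝ, 0 < κ₀ ∧
      1 ≤ ∫⁻ ω, ENNReal.ofReal (⨅ x : unitSphere d, ‖rowMul (M 0 ω) x‖ ^ κ₀) ∂μ ∧
      ∫⁻ ω, ENNReal.ofReal (matNorm (M 0 ω) ^ κ₀ * Real.posLog (matNorm (M 0 ω))) ∂μ < ⊤ ∧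
      0 < ∫⁻ ω, ENNReal.ofReal (‖Q 0 ω‖ ^ κ₀) ∂μ ∧
      ∫⁻ ω, ENNReal.ofReal (‖Q 0 ω‖ ^ κ₀) ∂μ < ⊤) :
    -- the series defining `R` converges almost surely, and no projection `x R` is bounded above
    (∀ᵐ ω ∂μ, Summable fun n => solTerm M Q n ω) ∧
    ∀ x ∈ unitSphere d, ∀ t : ℝ, μ {ω | inner ℝ x (stationarySol M Q ω) ≤ t} < 1 := by
  obtain ⟨κ, hκ, hinf, -, -, hQmom⟩ := hA7
  have hpair : ∀ n, Measurable fun ω => (M n ω, Q n ω) := fun n => (hM n).prodMk (hQ n)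
  have hsum : ∀ᵐ ω ∂μ, Summable fun n => solTerm M Q n ω :=
    ae_summable_solTerm (fun n => (hident n).comp measurable_snd) hβ hβneg hκ hQmom
  refine ⟨hsum, fun x hx t => ?_⟩
  by_contra hge
  have hx1 : ‖x‖ = 1 := by simpa using hx
  have hRm := aemeasurable_stationarySol hM hQ hsum
  set K := (μ.map (stationarySol M Q)).support with hKdef
  have hKclosed : IsClosed K := Measure.isClosed_support
  have hmaps0 : ∀ᵐ ω ∂μ, ∀ v ∈ K, mulCol (M 0 ω) v + Q 0 ω ∈ K :=
    ae_mapsTo_support hM hQ hindep hident hsum hA3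
  have hmaps : ∀ᵐ ω ∂μ, ∀ n, ∀ v ∈ K, mulCol (M n ω) v + Q n ω ∈ K := by
    have hcl : IsClosed {p : Mat d × Vec d | ∀ v ∈ K, mulCol p.1 v + p.2 ∈ K} := by
      simp only [Set.ofPred_forall]
      refine isClosed_iInter fun v => isClosed_iInter fun _ => hKclosed.preimage ?_
      exact (continuous_mulCol.comp (continuous_fst.prodMk continuous_const)).add continuous_snd
    exact ae_all_iff.2 fun n => (hident n).symm.ae_snd hcl.measurableSet hmaps0
  have hbdd : Bornology.IsBounded K := by
    refine isBounded_of_bddAbove_of_irreducible hmaps (hA4 x hx) ⟨t, ?_⟩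
    have hcl : IsClosed {v : Vec d | (inner ℝ x v : ℝ) ≤ t} :=
      isClosed_le (continuous_const.inner continuous_id) continuous_const
    have hae : ∀ᵐ ω ∂μ, (inner ℝ x (stationarySol M Q ω) : ℝ) ≤ t :=
      (mem_ae_iff_prob_eq_one₀ (hRm.nullMeasurableSet_preimage hcl.measurableSet)).2
        (le_antisymm prob_le_one (not_lt.1 hge))
    have hsub : K ⊆ {v : Vec d | (inner ℝ x v : ℝ) ≤ t} :=
      Measure.support_subset_of_isClosed hcl ((ae_map_iff hRm hcl.measurableSet).2 hae)
    rintro _ ⟨v, hv, rfl⟩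
    exact hsub hv
  have hnontriv : ¬ K.Subsingleton := by
    intro hK
    have : IsProbabilityMeasure (μ.map (stationarySol M Q)) := Measure.isProbabilityMeasure_map hRm
    obtain ⟨v, hv⟩ : K.Nonempty := Measure.nonempty_support (IsProbabilityMeasure.ne_zero _)
    refine (hA6 v).ne ?_
    have hfix : ∀ᵐ ω ∂μ, mulCol (M 0 ω) v + Q 0 ω = v := by
      filter_upwards [hmaps0] with ω hω using hK (hω v hv) hv
    rw [measure_congr (eventuallyEq_univ.2 hfix), measure_univ]
  have hle : ∀ᵐ ω ∂μ, (⨅ y : unitSphere d, ‖rowMul (M 0 ω) y‖ ^ κ) ≤ 1 := by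
    filter_upwards [hmaps0] with ω hω
    by_contra! hlt
    exact hnontriv (subsingleton_of_mapsTo_expanding
      (Real.one_lt_rpow hlt (inv_pos.2 hκ))
      (rpow_inv_mul_norm_le_norm_rowMul hκ (zero_le_one.trans hlt.le) le_rfl) hbdd hω)
  -- a variable that is at most `1` and whose mean is at least `1` equals `1`
  have heq : (fun ω => ENNReal.ofReal (⨅ y : unitSphere d, ‖rowMul (M 0 ω) y‖ ^ κ)) =ᵐ[μ]
      fun _ => 1 := by
    have hle' : (fun ω => ENNReal.ofReal (⨅ y : unitSphere d, ‖rowMul (M 0 ω) y‖ ^ κ)) ≤ᵐ[μ]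
        fun _ => 1 := by
      filter_upwards [hle] with ω hω using ENNReal.ofReal_le_one.2 hω
    refine ae_eq_of_ae_le_of_lintegral_le hle' ?_ aemeasurable_const (by simpa using hinf)
    exact ((lintegral_mono_ae hle').trans_lt (by simp)).ne
  have hexp0 : ∀ᵐ ω ∂μ, ∀ y : Vec d, ‖y‖ ≤ ‖rowMul (M 0 ω) y‖ := by
    filter_upwards [heq] with ω hω y
    simpa using rpow_inv_mul_norm_le_norm_rowMul hκ zero_le_one
      (ENNReal.one_le_ofReal.1 hω.ge) y
  have hexp : ∀ᵐ ω ∂μ, ∀ n (y : Vec d), ‖y‖ ≤ ‖rowMul (M n ω) y‖ := by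
    have hcl : IsClosed {p : Mat d × Vec d | ∀ y : Vec d, ‖y‖ ≤ ‖rowMul p.1 y‖} := by
      simp only [Set.ofPred_forall]
      exact isClosed_iInter fun y => isClosed_le continuous_const
        ((continuous_rowMul_apply y).comp continuous_fst).norm
    exact ae_all_iff.2 fun n => (hident n).symm.ae_snd hcl.measurableSet hexp0
  exact (hβ.nonneg_of_expanding hexp hx1).not_gt hβneg
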